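/- Let $(\Omega,\mathcal F,P)$ be a probability space and let $\omega\colon[0,\infty)\to[0,\infty)$ be a continuous, non-decreasing, concave function with $\omega(0)=0$. Let $\mathcal R$ be the set of all random variables on $\Omega$ with values in $[0,1]$, and put $\|\eta\|_\infty=\operatorname{ess\,sup}_{w\in\Omega}|\eta(w)|$. Let $\mathcal H^\omega$ be the class of all measurable (that is, jointly measurable in $(t,w)$) random processes $\xi_t$, $t\in[0,1]$, on $\Omega$ such that $\mathbf E|\xi_\tau-\xi_\theta|\le\omega(\|\tau-\theta\|_\infty)$ for all $\tau,\theta\in\mathcal R$. For $\tau_1,\dots,\tau_n\in\mathcal R$, a method of recovery is an arbitrary map $\varphi$ from $n$-tuples of real random variables on $\Omega$ to real random variables on $\Omega$; its error is $$e(\tau_1,\dots,\tau_n;\varphi)=\sup_{\xi\in\mathcal H^\omega}\mathbf E\left|\int_0^1\xi_t\,dt-\varphi(\xi_{\tau_1},\dots,\xi_{\tau_n})\right|,$$ and the optimal error is $E(\tau_1,\dots,\tau_n)=\inf_\varphi e(\tau_1,\dots,\tau_n;\varphi)$. Put $I(t)=\int_0^t\omega(s)\,ds$ for $t\ge0$.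 Theorem. Let $n\ge1$, let $\tau\in\mathcal R$, and let the numbers $0=t_1<\dots<t_n$ be such that $\tau+t_n\le1$ almost everywhere. Let $\tau_k\in\mathcal R$ with $\tau_k=\tau+t_k$ almost everywhere, $k=1,\dots,n$, and let $t^*=\left\|\tau-\frac{1-t_n}2\right\|_\infty$. Then $$E(\tau_1,\dots,\tau_n)=2\sum_{k=1}^{n-1}I\left(\frac{t_{k+1}-t_k}2\right)+I\left(\frac{1-t_n}2-t^*\right)+I\left(\frac{1-t_n}2+t^*\right).$$ Moreover, the infimum is attained by the method $(x_1,\dots,x_n)\mapsto\sum_{k=1}^n c_k^*x_k$, that is, by $\sum_{k=1}^n c_k^*\xi_{\tau_k}$, with the (partly random) weights $$c_1^*=\tau+\frac{t_2-t_1}2,\qquad c_k^*=\frac{t_{k+1}-t_{k-1}}2\quad(2\le k\le n-1),\qquad c_n^*=1-\tau-\frac{t_n+t_{n-1}}2$$ if $n\ge2$, and with $c_1^*=1$ if $n=1$. -/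

import Mathlib

open MeasureTheory
open scoped ENNReal

/-- A concave modulus of continuity: a continuous, non-decreasing, concave function
`ω : [0, ∞) → [0, ∞)` with `ω 0 = 0` (the values of `ω` at negative arguments are never used). -/
structure IsConcaveModulus (ω : ℝ → ℝ) : Prop where
  continuousOn : ContinuousOn ω (Set.Ici 0)
  monotoneOn : MonotoneOn ω (Set.Ici 0)
  concaveOn : ConcaveOn ℝ (Set.Ici 0) ω
  nonneg : ∀ s, 0 ≤ s → 0 ≤ ω s
  map_zero : ω 0 = 0

noncomputable section

/-- `‖η‖_∞ = ess sup |η|`, as a real number (used for bounded random variables only). -/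
def supNorm {Ω : Type*} [MeasurableSpace Ω] (P : Measure Ω) (η : Ω → ℝ) : ℝ :=
  (eLpNorm η ∞ P).toReal

/-- The class `𝓗^ω` of measurable random processes `ξ_t`, `t ∈ [0, 1]` (jointly measurable in
`(t, w)`), such that `E |ξ_τ - ξ_θ| ≤ ω (‖τ - θ‖_∞)` for all `[0, 1]`-valued random variables
`τ`, `θ`. -/
def processClass {Ω : Type*} [MeasurableSpace Ω] (P : Measure Ω) (ω : ℝ → ℝ) :
    Set (Set.Icc (0 : ℝ) 1 → Ω → ℝ) :=
  {ξ | Measurable (fun p : Set.Icc (0 : ℝ) 1 × Ω => ξ p.1 p.2) ∧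
    ∀ τ θ : Ω → Set.Icc (0 : ℝ) 1, Measurable τ → Measurable θ →
      ∫⁻ w, ‖ξ (τ w) w - ξ (θ w) w‖ₑ ∂P
        ≤ ENNReal.ofReal (ω (supNorm P (fun w => (τ w : ℝ) - (θ w : ℝ))))}

/-- Almost every path of a process of the class is integrable over `[0, 1]`, so that the
integral `∫_0^1 ξ_t dt` is a well defined random variable. -/
theorem ae_integrable_path {Ω : Type*} [MeasurableSpace Ω] (P : Measure Ω)
    [IsProbabilityMeasure P] {ω : ℝ → ℝ} (hω : IsConcaveModulus ω)
    {ξ : Set.Icc (0 : ℝ) 1 → Ω → ℝ} (hξ : ξ ∈ processClass P ω) :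
    ∀ᵐ w ∂P, Integrable (fun t => ξ t w) := by
  obtain ⟨hm, hb⟩ := hξ
  have hm0 : Measurable (fun w => ξ 0 w) := hm.comp measurable_prodMk_left
  have hd : Measurable (fun p : Ω × Set.Icc (0 : ℝ) 1 => ‖ξ p.2 p.1 - ξ 0 p.1‖ₑ) :=
    ((hm.comp measurable_swap).sub (hm0.comp measurable_fst)).enorm
  have hbound : ∀ t : Set.Icc (0 : ℝ) 1,
      ∫⁻ w, ‖ξ t w - ξ 0 w‖ₑ ∂P ≤ ENNReal.ofReal (ω 1) := by
    intro t
    refine (hb (fun _ => t) (fun _ => 0) measurable_const measurable_const).trans ?_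
    apply ENNReal.ofReal_le_ofReal
    apply hω.monotoneOn (Set.mem_Ici.2 ENNReal.toReal_nonneg) (Set.mem_Ici.2 zero_le_one)
    have h1 : eLpNorm (fun _ : Ω => (t : ℝ) - ((0 : Set.Icc (0 : ℝ) 1) : ℝ)) ∞ P ≤ 1 := by
      rw [eLpNorm_exponent_top]
      refine eLpNormEssSup_le_of_ae_enorm_bound (Filter.Eventually.of_forall fun _ => ?_)
      have : ‖(t : ℝ) - ((0 : Set.Icc (0 : ℝ) 1) : ℝ)‖ ≤ 1 := by
        have h0 : ((0 : Set.Icc (0 : ℝ) 1) : ℝ) = 0 := rfl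
        rw [h0, sub_zero, Real.norm_eq_abs, abs_of_nonneg t.2.1]
        exact t.2.2
      rw [← ofReal_norm]
      simpa using this
    exact ENNReal.toReal_le_of_le_ofReal zero_le_one (by simpa using h1)
  have hfin : ∫⁻ w, ∫⁻ t, ‖ξ t w - ξ 0 w‖ₑ ∂volume ∂P ≠ ∞ := by
    rw [lintegral_lintegral_swap hd.aemeasurable]
    refine ne_top_of_le_ne_top ?_ (lintegral_mono hbound)
    simp
  filter_upwards [ae_lt_top hd.lintegral_prod_right' hfin] with w hw
  have hmw : Measurable (fun t => ξ t w) := hm.comp measurable_prodMk_right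
  have h1 : Integrable (fun t => ξ t w - ξ 0 w) :=
    ⟨(hmw.sub measurable_const).aestronglyMeasurable, hw⟩
  have h2 := h1.add (integrable_const (ξ 0 w))
  exact h2.congr (Filter.Eventually.of_forall fun t => by simp)

/-- A method of recovery from `n` random variables: an arbitrary map `φ` taking `n`-tuples of
random variables to random variables. -/
def IsRecoveryMethod {Ω : Type*} [MeasurableSpace Ω] {n : ℕ}
    (φ : (Fin n → Ω → ℝ) → Ω → ℝ) : Prop :=
  ∀ x : Fin n → Ω → ℝ, (∀ k, Measurable (x k)) → Measurable (φ x)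

/-- The error of the method `φ` that uses `ξ_{τ_1}, …, ξ_{τ_n}`:
`sup_{ξ ∈ 𝓗^ω} E |∫_0^1 ξ_t dt - φ (ξ_{τ_1}, …, ξ_{τ_n})|`, an element of `[0, ∞]`. -/
def recoveryError {Ω : Type*} [MeasurableSpace Ω] (P : Measure Ω) (ω : ℝ → ℝ) {n : ℕ}
    (τs : Fin n → Ω → Set.Icc (0 : ℝ) 1) (φ : (Fin n → Ω → ℝ) → Ω → ℝ) : ℝ≥0∞ :=
  ⨆ ξ ∈ processClass P ω,
    ∫⁻ w, ‖(∫ t, ξ t w) - φ (fun k w' => ξ (τs k w') w') w‖ₑ ∂P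

/-- The optimal error `E(τ_1, …, τ_n)`: the infimum of the errors of all recovery methods. -/
def optimalError {Ω : Type*} [MeasurableSpace Ω] (P : Measure Ω) (ω : ℝ → ℝ) {n : ℕ}
    (τs : Fin n → Ω → Set.Icc (0 : ℝ) 1) : ℝ≥0∞ :=
  ⨅ φ : (Fin n → Ω → ℝ) → Ω → ℝ, ⨅ _ : IsRecoveryMethod φ, recoveryError P ω τs φ

/-- `I(t) = ∫_0^t ω(s) ds`. -/
def modulusIntegral (ω : ℝ → ℝ) (t : ℝ) : ℝ := ∫ s in (0 : ℝ)..t, ω s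

/-- The weights of the optimal quadrature with `n = m + 1` nodes; indices are shifted by one,
so `t 0, …, t (Fin.last m)` are `t_1, …, t_n`. The first and the last weight are random. For a
single node the weight is `1`. (In the branches where `k + 1` and `k - 1` occur, the addition and
subtraction in `Fin (m + 1)` do not wrap around.) -/
def optimalWeight {Ω : Type*} {m : ℕ} (τ : Ω → Set.Icc (0 : ℝ) 1) (t : Fin (m + 1) → ℝ)
    (k : Fin (m + 1)) (w : Ω) : ℝ :=
  if m = 0 then 1
  else if k = 0 then (τ w : ℝ) + (t 1 - t 0) / 2
  else if k = Fin.last m then 1 - (τ w : ℝ) - (t (Fin.last m) + t (Fin.last m - 1)) / 2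
  else (t (k + 1) - t (k - 1)) / 2

/-- The linear method `(x_1, …, x_n) ↦ ∑ c_k x_k` with the weights above. -/
def optimalQuadrature {Ω : Type*} {m : ℕ} (τ : Ω → Set.Icc (0 : ℝ) 1) (t : Fin (m + 1) → ℝ) :
    (Fin (m + 1) → Ω → ℝ) → Ω → ℝ :=
  fun x w => ∑ k, optimalWeight τ t k w * x k w

end

/-! ### Quadrature along a single path -/

/-! Write `T` for the last offset `t_n`, `p` for a value of `τ`, and `a = (1 - T) / 2`.

Upper bound. The weights are the lengths of the Voronoi cells of the nodes, so the error is a sum of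
integrals of increments between a node and a point at distance `s`. A half-cell between two nodes
has a deterministic length, and Tonelli with `E |increment| ≤ ω s` gives `I` of that length. The two
end intervals have random lengths `p` and `1 - T - p`, but their sum is fixed and the shorter one
has length at least `a - t*`. The part of the shorter one beyond `a - t*` is reflected and appended
to the longer one (`lintegral_Ioc_add_le_rearrange`). The ranges become the deterministic `a - t*`
and `a + t*`, and a point filed under `s` is still within `s` of its node (`abs_mixedPoint_sub_le`).
Which end is used depends on the outcome; this is harmless because the class controls increments at
random times.

Lower bound. The process `ω (distance to the nearest node)`, concentrated on an event `A` and
divided by `P A`, lies in the class and vanishes at the nodes, so no method separates it from its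
negative (`lintegral_enorm_integral_le_recoveryError`). For `A = {|τ - a| > r}` with `r < t*`, its
integral yields the claimed value with `r` in place of `t*` (`le_optimalError_of_lt`); then `r`
tends to `t*`. -/

theorem sum_optimalWeight_mul {Ω : Type*} {m : ℕ} (τ : Ω → Set.Icc (0 : ℝ) 1)
    (t : Fin (m + 1) → ℝ) (ht0 : t 0 = 0) (f : Fin (m + 1) → ℝ) (w : Ω) :
    ∑ k, optimalWeight τ t k w * f k = (τ w : ℝ) * f 0
      + ∑ k : Fin m, (t k.succ - t k.castSucc) / 2 * (f k.castSucc + f k.succ)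
      + (1 - (τ w : ℝ) - t (Fin.last m)) * f (Fin.last m) := by
  rcases m with _ | m
  · simp [optimalWeight, ht0]
    ring
  -- Sums over gaps become sums over nodes; the coefficient is zero at the node with no right (resp.
  -- left) neighbour, where `k + 1` (resp. `k - 1`) would wrap around.
  · have hL : ∑ k : Fin (m + 1), (t k.succ - t k.castSucc) / 2 * f k.castSucc
        = ∑ k : Fin (m + 2), (if k = Fin.last _ then 0 else (t (k + 1) - t k) / 2) * f k := by
      rw [Fin.sum_univ_castSucc (n := m + 1)]
      simp [Fin.castSucc_ne_last]
    have hR : ∑ k : Fin (m + 1), (t k.succ - t k.castSucc) / 2 * f k.succ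
        = ∑ k : Fin (m + 2), (if k = 0 then 0 else (t k - t (k - 1)) / 2) * f k := by
      rw [Fin.sum_univ_succ (n := m + 1)]
      have hk : ∀ k : Fin (m + 1), k.succ - 1 = k.castSucc := fun k => by
        rw [← Fin.coeSucc_eq_succ, add_sub_cancel_right]
      simp [Fin.succ_ne_zero, hk]
    have h0 : (τ w : ℝ) * f 0
        = ∑ k : Fin (m + 2), (if k = 0 then (τ w : ℝ) else 0) * f k := by
      simp
    have hl : (1 - (τ w : ℝ) - t (Fin.last _)) * f (Fin.last _)
        = ∑ k : Fin (m + 2), (if k = Fin.last _ then (1 - (τ w : ℝ) - t (Fin.last _)) else 0)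
          * f k := by
      simp
    simp only [mul_add, Finset.sum_add_distrib]
    rw [hL, hR, h0, hl, ← Finset.sum_add_distrib, ← Finset.sum_add_distrib,
      ← Finset.sum_add_distrib]
    refine Finset.sum_congr rfl fun k _ => ?_
    have hne : (0 : Fin (m + 2)) ≠ Fin.last _ := by simp [Fin.ext_iff]
    unfold optimalWeight
    by_cases hk0 : k = 0
    · subst hk0
      simp [hne]
      ring
    · by_cases hkl : k = Fin.last _
      · subst hkl
        simp
        ring
      · simp [hk0, hkl]
        ring

theorem Fin.sum_succ_sub_castSucc {m : ℕ} (F : Fin (m + 1) → ℝ) :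
    ∑ k : Fin m, (F k.succ - F k.castSucc) = F (Fin.last m) - F 0 := by
  induction m with
  | zero => simp
  | succ m ih =>
    rw [Fin.sum_univ_castSucc]
    have := ih (fun k => F k.castSucc)
    simp only [Fin.succ_castSucc, Fin.succ_last, Fin.castSucc_zero] at this ⊢
    rw [this]
    ring

theorem enorm_integral_sub_mul_left_le {f : ℝ → ℝ} {c d : ℝ} (hd : 0 ≤ d)
    (hf : IntervalIntegrable f volume (c - d) c) :
    ‖(∫ x in (c - d)..c, f x) - d * f c‖ₑ ≤ ∫⁻ s in Set.Ioc 0 d, ‖f (c - s) - f c‖ₑ := by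
  have h1 : IntervalIntegrable (fun s => f (c - s)) volume 0 d := by
    have := hf.comp_sub_left c
    simpa using this.symm
  have h2 : (∫ x in (c - d)..c, f x) - d * f c = ∫ s in (0 : ℝ)..d, (f (c - s) - f c) := by
    rw [intervalIntegral.integral_sub h1 intervalIntegrable_const,
      intervalIntegral.integral_comp_sub_left]
    simp
  rw [h2, intervalIntegral.integral_of_le hd]
  exact enorm_integral_le_lintegral_enorm _

theorem enorm_integral_sub_mul_right_le {f : ℝ → ℝ} {c d : ℝ} (hd : 0 ≤ d)
    (hf : IntervalIntegrable f volume c (c + d)) :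
    ‖(∫ x in c..(c + d), f x) - d * f c‖ₑ ≤ ∫⁻ s in Set.Ioc 0 d, ‖f (c + s) - f c‖ₑ := by
  have h1 : IntervalIntegrable (fun s => f (c + s)) volume 0 d := by
    have := hf.comp_add_left c
    simpa using this
  have h2 : (∫ x in c..(c + d), f x) - d * f c = ∫ s in (0 : ℝ)..d, (f (c + s) - f c) := by
    rw [intervalIntegral.integral_sub h1 intervalIntegrable_const,
      intervalIntegral.integral_comp_add_left]
    simp
  rw [h2, intervalIntegral.integral_of_le hd]
  exact enorm_integral_le_lintegral_enorm _

/-- The integral over `[0, 1]`, split into the halves of the cells of the nodes `p + t k`. -/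
theorem integral_eq_sum_integral_cells {m : ℕ} {f : ℝ → ℝ} (hf : IntegrableOn f (Set.Icc 0 1))
    {t : Fin (m + 1) → ℝ} (ht0 : t 0 = 0) (ht : Monotone t) {p : ℝ} (hp : 0 ≤ p)
    (hp1 : p + t (Fin.last m) ≤ 1) :
    ∫ x in (0 : ℝ)..1, f x = (∫ x in (p - p)..p, f x)
      + ∑ k : Fin m, ((∫ x in (p + t k.castSucc)..((p + t k.castSucc)
              + (t k.succ - t k.castSucc) / 2), f x)
          + ∫ x in ((p + t k.succ) - (t k.succ - t k.castSucc) / 2)..(p + t k.succ), f x)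
      + ∫ x in (p + t (Fin.last m))..(p + t (Fin.last m) + (1 - t (Fin.last m) - p)), f x := by
  have hmem : ∀ k, p + t k ∈ Set.Icc (0 : ℝ) 1 := fun k => by
    have h1 := ht (Fin.zero_le k)
    have h2 := ht (Fin.le_last k)
    constructor <;> linarith
  have hint : ∀ {x y : ℝ}, x ∈ Set.Icc (0 : ℝ) 1 → y ∈ Set.Icc (0 : ℝ) 1 →
      IntervalIntegrable f volume x y := fun hx hy =>
    (hf.mono_set (Set.uIcc_subset_Icc hx hy)).intervalIntegrable
  have h0 : (0 : ℝ) ∈ Set.Icc (0 : ℝ) 1 := by simp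
  have h1 : (1 : ℝ) ∈ Set.Icc (0 : ℝ) 1 := by simp
  have hl := hmem (Fin.last m)
  have hp0 : p ∈ Set.Icc (0 : ℝ) 1 := by simpa [ht0] using hmem 0
  have hmid : ∀ k : Fin m, (p + t k.castSucc) + (t k.succ - t k.castSucc) / 2
      ∈ Set.Icc (0 : ℝ) 1 := fun k => by
    have h1 := hmem k.castSucc
    have h2 := hmem k.succ
    constructor <;> linarith [h1.1, h1.2, h2.1, h2.2]
  have hmid' : ∀ k : Fin m, (p + t k.castSucc) + (t k.succ - t k.castSucc) / 2
      = (p + t k.succ) - (t k.succ - t k.castSucc) / 2 := fun k => by ring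
  have hlen : ∀ k : Fin m, 0 ≤ (t k.succ - t k.castSucc) / 2 := fun k => by
    have := ht (Fin.castSucc_le_succ k)
    linarith
  have hk : ∀ k : Fin m, ((∫ x in (p + t k.castSucc)..((p + t k.castSucc)
            + (t k.succ - t k.castSucc) / 2), f x)
        + ∫ x in ((p + t k.succ) - (t k.succ - t k.castSucc) / 2)..(p + t k.succ), f x)
      = (∫ x in (0 : ℝ)..(p + t k.succ), f x) - ∫ x in (0 : ℝ)..(p + t k.castSucc), f x := by
    intro k
    rw [← hmid' k, intervalIntegral.integral_add_adjacent_intervals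
      (hint (hmem _) (hmid k)) (hint (hmid k) (hmem _)),
      intervalIntegral.integral_interval_sub_left (hint h0 (hmem _)) (hint h0 (hmem _))]
  -- The two halves of a gap meet at its midpoint, so the sum over gaps telescopes.
  rw [Finset.sum_congr rfl fun k _ => hk k,
    Fin.sum_succ_sub_castSucc (fun k => ∫ x in (0 : ℝ)..(p + t k), f x), ht0, sub_self,
    add_zero, add_sub_cancel, show p + t (Fin.last m) + (1 - t (Fin.last m) - p) = 1 by ring,
    intervalIntegral.integral_add_adjacent_intervals (hint h0 hl) (hint hl h1)]

/-- Error of the quadrature with nodes `p + t k` and weights given by the lengths of the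
Voronoi cells, in terms of the increments of the path at the nodes. -/
theorem enorm_quadrature_error_le {m : ℕ} {f : ℝ → ℝ} (hf : IntegrableOn f (Set.Icc 0 1))
    {t : Fin (m + 1) → ℝ} (ht0 : t 0 = 0) (ht : Monotone t) {p : ℝ} (hp : 0 ≤ p)
    (hp1 : p + t (Fin.last m) ≤ 1) :
    ‖(∫ x in (0 : ℝ)..1, f x) - (p * f p
        + ∑ k : Fin m, (t k.succ - t k.castSucc) / 2 * (f (p + t k.castSucc) + f (p + t k.succ))
        + (1 - p - t (Fin.last m)) * f (p + t (Fin.last m)))‖ₑ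
      ≤ ∑ k : Fin m, ((∫⁻ s in Set.Ioc 0 ((t k.succ - t k.castSucc) / 2),
            ‖f (p + t k.castSucc + s) - f (p + t k.castSucc)‖ₑ)
          + ∫⁻ s in Set.Ioc 0 ((t k.succ - t k.castSucc) / 2),
            ‖f (p + t k.succ - s) - f (p + t k.succ)‖ₑ)
        + ((∫⁻ s in Set.Ioc 0 p, ‖f (p - s) - f p‖ₑ)
          + ∫⁻ s in Set.Ioc 0 (1 - t (Fin.last m) - p),
            ‖f (p + t (Fin.last m) + s) - f (p + t (Fin.last m))‖ₑ) := by
  have hmem : ∀ k, p + t k ∈ Set.Icc (0 : ℝ) 1 := fun k => by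
    have h1 := ht (Fin.zero_le k)
    have h2 := ht (Fin.le_last k)
    constructor <;> linarith
  have hint : ∀ {x y : ℝ}, x ∈ Set.Icc (0 : ℝ) 1 → y ∈ Set.Icc (0 : ℝ) 1 →
      IntervalIntegrable f volume x y := fun hx hy =>
    (hf.mono_set (Set.uIcc_subset_Icc hx hy)).intervalIntegrable
  have h0 : (0 : ℝ) ∈ Set.Icc (0 : ℝ) 1 := by simp
  have h1 : (1 : ℝ) ∈ Set.Icc (0 : ℝ) 1 := by simp
  have hl := hmem (Fin.last m)
  have hp0 : p ∈ Set.Icc (0 : ℝ) 1 := by simpa [ht0] using hmem 0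
  have hmid : ∀ k : Fin m, (p + t k.castSucc) + (t k.succ - t k.castSucc) / 2
      ∈ Set.Icc (0 : ℝ) 1 := fun k => by
    have h1 := hmem k.castSucc
    have h2 := hmem k.succ
    constructor <;> linarith [h1.1, h1.2, h2.1, h2.2]
  have hmid' : ∀ k : Fin m, (p + t k.castSucc) + (t k.succ - t k.castSucc) / 2
      = (p + t k.succ) - (t k.succ - t k.castSucc) / 2 := fun k => by ring
  have hlen : ∀ k : Fin m, 0 ≤ (t k.succ - t k.castSucc) / 2 := fun k => by
    have := ht (Fin.castSucc_le_succ k)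
    linarith
  have hsum := integral_eq_sum_integral_cells hf ht0 ht hp hp1
  have hsplit : (∫ x in (0 : ℝ)..1, f x) - (p * f p
        + ∑ k : Fin m, (t k.succ - t k.castSucc) / 2 * (f (p + t k.castSucc) + f (p + t k.succ))
        + (1 - p - t (Fin.last m)) * f (p + t (Fin.last m)))
      = ∑ k : Fin m, (((∫ x in (p + t k.castSucc)..((p + t k.castSucc)
              + (t k.succ - t k.castSucc) / 2), f x)
            - (t k.succ - t k.castSucc) / 2 * f (p + t k.castSucc))
          + ((∫ x in ((p + t k.succ) - (t k.succ - t k.castSucc) / 2)..(p + t k.succ), f x)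
            - (t k.succ - t k.castSucc) / 2 * f (p + t k.succ)))
        + (((∫ x in (p - p)..p, f x) - p * f p)
          + ((∫ x in (p + t (Fin.last m))..(p + t (Fin.last m) + (1 - t (Fin.last m) - p)), f x)
            - (1 - t (Fin.last m) - p) * f (p + t (Fin.last m)))) := by
    rw [hsum]
    simp only [mul_add, Finset.sum_add_distrib, Finset.sum_sub_distrib]
    ring
  rw [hsplit]
  refine (enorm_add_le _ _).trans (add_le_add ?_ ?_)
  · refine (enorm_sum_le _ _).trans (Finset.sum_le_sum fun k _ => ?_)
    refine (enorm_add_le _ _).trans (add_le_add ?_ ?_)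
    · exact enorm_integral_sub_mul_right_le (hlen k) (hint (hmem _) (hmid k))
    · exact enorm_integral_sub_mul_left_le (hlen k) (hint (hmid' k ▸ hmid k) (hmem _))
  · refine (enorm_add_le _ _).trans (add_le_add ?_ ?_)
    · exact enorm_integral_sub_mul_left_le hp (hint (by simp) hp0)
    · refine enorm_integral_sub_mul_right_le (by linarith) (hint hl ?_)
      rw [show p + t (Fin.last m) + (1 - t (Fin.last m) - p) = 1 by ring]
      exact h1

/-- Moving the part of the shorter interval beyond `r` to the end of the longer one. -/
theorem lintegral_Ioc_add_le_rearrange {N F : ℝ → ℝ≥0∞} {r q b : ℝ} (hr : 0 ≤ r)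
    (hrq : r ≤ q) (hqb : q ≤ b) :
    (∫⁻ s in Set.Ioc 0 q, N s) + ∫⁻ s in Set.Ioc 0 (b - q), F s
      ≤ (∫⁻ s in Set.Ioc 0 r, N s)
        + ∫⁻ s in Set.Ioc 0 (b - r), if s ≤ b - q then F s else N (b - s) := by
  have h1 : ∫⁻ s in Set.Ioc 0 q, N s
      ≤ (∫⁻ s in Set.Ioc 0 r, N s) + ∫⁻ s in Set.Ioc r q, N s := by
    rw [← Set.Ioc_union_Ioc_eq_Ioc hr hrq]
    exact lintegral_union_le _ _ _
  -- The reflection `s ↦ b - s` carries the excess `(r, q]` to an interval that starts exactly where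
  -- `(0, b - q]` ends.
  have h2 : ∫⁻ s in Set.Ioc r q, N s = ∫⁻ s in Set.Ioc (b - q) (b - r), N (b - s) := by
    have hmp : MeasurePreserving (fun s : ℝ => b - s) volume volume := by
      simpa only [Function.comp_def, sub_eq_add_neg] using
        (measurePreserving_add_left volume b).comp (Measure.measurePreserving_neg volume)
    have := hmp.setLIntegral_comp_preimage_emb
      (MeasurableEquiv.subLeft b).measurableEmbedding N (Set.Ioc r q)
    rw [← this, Set.preimage_const_sub_Ioc]
    exact setLIntegral_congr Ico_ae_eq_Ioc
  have h3 : ∫⁻ s in Set.Ioc 0 (b - r), (if s ≤ b - q then F s else N (b - s))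
      = (∫⁻ s in Set.Ioc 0 (b - q), F s) + ∫⁻ s in Set.Ioc (b - q) (b - r), N (b - s) := by
    rw [← Set.Ioc_union_Ioc_eq_Ioc (sub_nonneg.2 hqb) (sub_le_sub_left hrq b),
      lintegral_union measurableSet_Ioc (Set.Ioc_disjoint_Ioc_of_le le_rfl)]
    congr 1
    · exact setLIntegral_congr_fun measurableSet_Ioc fun s hs => if_pos hs.2
    · exact setLIntegral_congr_fun measurableSet_Ioc fun s hs => if_neg (not_le.2 hs.1)
  rw [h3, ← h2]
  refine (add_le_add_left h1 _).trans (le_of_eq ?_)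
  ring

/-! ### The modulus -/

/-- Concavity on the segment from `0` to `x + y`, with `ω 0 = 0`, bounds `ω x` and `ω y` below by
proportional shares of `ω (x + y)`. -/
theorem IsConcaveModulus.subadditive {ω : ℝ → ℝ} (hω : IsConcaveModulus ω) {x y : ℝ}
    (hx : 0 ≤ x) (hy : 0 ≤ y) : ω (x + y) ≤ ω x + ω y := by
  rcases eq_or_lt_of_le (add_nonneg hx hy) with h | h
  · rw [← h, hω.map_zero]
    exact add_nonneg (hω.nonneg _ hx) (hω.nonneg _ hy)
  · have key : ∀ z, 0 ≤ z → z ≤ x + y → z / (x + y) * ω (x + y) ≤ ω z := fun z hz hzs => by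
      have h1 : 0 ≤ 1 - z / (x + y) := by
        rw [sub_nonneg, div_le_one h]
        exact hzs
      have h2 := hω.concaveOn.2 (Set.mem_Ici.2 h.le) (Set.mem_Ici.2 le_rfl)
        (div_nonneg hz h.le) h1 (by ring)
      simp only [smul_eq_mul, mul_zero, add_zero, hω.map_zero] at h2
      rwa [div_mul_cancel₀ _ h.ne'] at h2
    have h1 := key x hx (by linarith)
    have h2 := key y hy (by linarith)
    have h3 : x / (x + y) * ω (x + y) + y / (x + y) * ω (x + y) = ω (x + y) := by
      field_simp
    linarith

theorem IsConcaveModulus.abs_sub_le {ω : ℝ → ℝ} (hω : IsConcaveModulus ω) {x y : ℝ}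
    (hx : 0 ≤ x) (hy : 0 ≤ y) : |ω x - ω y| ≤ ω |x - y| := by
  have key : ∀ {x y : ℝ}, 0 ≤ x → 0 ≤ y → ω x - ω y ≤ ω |x - y| := fun {x y} hx hy => by
    have h1 : ω x ≤ ω (y + |x - y|) := hω.monotoneOn hx
      (Set.mem_Ici.2 (by positivity)) (by linarith [le_abs_self (x - y)])
    linarith [hω.subadditive hy (abs_nonneg (x - y))]
  rw [_root_.abs_sub_le_iff]
  exact ⟨key hx hy, abs_sub_comm x y ▸ key hy hx⟩

/-- The even extension is continuous on the whole line and changes neither the process class nor `I`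
on `[0, ∞)`, so continuity everywhere may be assumed. -/
theorem IsConcaveModulus.comp_abs {ω : ℝ → ℝ} (hω : IsConcaveModulus ω) :
    IsConcaveModulus (fun x => ω |x|) := by
  have h : Set.EqOn (fun x => ω |x|) ω (Set.Ici 0) := fun x hx => by
    simp only [abs_of_nonneg (Set.mem_Ici.1 hx)]
  exact ⟨hω.continuousOn.congr h, hω.monotoneOn.congr h.symm, hω.concaveOn.congr h.symm,
    fun s _ => hω.nonneg _ (abs_nonneg s), by simp [hω.map_zero]⟩

theorem IsConcaveModulus.continuous_comp_abs {ω : ℝ → ℝ} (hω : IsConcaveModulus ω) :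
    Continuous (fun x => ω |x|) :=
  hω.continuousOn.comp_continuous continuous_abs fun x => abs_nonneg x

theorem modulusIntegral_comp_abs (ω : ℝ → ℝ) {x : ℝ} (hx : 0 ≤ x) :
    modulusIntegral (fun x => ω |x|) x = modulusIntegral ω x := by
  refine intervalIntegral.integral_congr fun s hs => ?_
  rw [Set.uIcc_of_le hx] at hs
  simp only [abs_of_nonneg hs.1]

theorem supNorm_nonneg {Ω : Type*} [MeasurableSpace Ω] (P : Measure Ω) (η : Ω → ℝ) :
    0 ≤ supNorm P η := ENNReal.toReal_nonneg

theorem supNorm_le {Ω : Type*} [MeasurableSpace Ω] {P : Measure Ω} {η : Ω → ℝ} {s : ℝ}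
    (hs : 0 ≤ s) (h : ∀ᵐ w ∂P, |η w| ≤ s) : supNorm P η ≤ s := by
  refine ENNReal.toReal_le_of_le_ofReal hs ?_
  rw [eLpNorm_exponent_top]
  refine eLpNormEssSup_le_of_ae_enorm_bound ?_
  filter_upwards [h] with w hw
  rw [← ofReal_norm]
  exact ENNReal.ofReal_le_ofReal hw

theorem ae_abs_le_supNorm {Ω : Type*} [MeasurableSpace Ω] {P : Measure Ω} {η : Ω → ℝ} {s : ℝ}
    (h : ∀ᵐ w ∂P, |η w| ≤ s) : ∀ᵐ w ∂P, |η w| ≤ supNorm P η := by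
  have hfin : eLpNorm η ∞ P ≠ ∞ := by
    refine ne_top_of_le_ne_top (ENNReal.ofReal_ne_top (r := s)) ?_
    rw [eLpNorm_exponent_top]
    refine eLpNormEssSup_le_of_ae_enorm_bound ?_
    filter_upwards [h] with w hw
    rw [← ofReal_norm]
    exact ENNReal.ofReal_le_ofReal hw
  filter_upwards [ae_le_eLpNormEssSup (f := η) (μ := P)] with w hw
  rw [← eLpNorm_exponent_top] at hw
  have := ENNReal.toReal_mono hfin hw
  rwa [toReal_enorm] at this

theorem processClass_comp_abs {Ω : Type*} [MeasurableSpace Ω] (P : Measure Ω) (ω : ℝ → ℝ) :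
    processClass P (fun x => ω |x|) = processClass P ω := by
  simp only [processClass, abs_of_nonneg (supNorm_nonneg _ _)]

theorem modulusIntegral_nonneg {ω : ℝ → ℝ} (hω : IsConcaveModulus ω) {x : ℝ} (hx : 0 ≤ x) :
    0 ≤ modulusIntegral ω x :=
  intervalIntegral.integral_nonneg hx fun s hs => hω.nonneg s hs.1

theorem continuous_modulusIntegral {ω : ℝ → ℝ} (hc : Continuous ω) :
    Continuous (modulusIntegral ω) :=
  intervalIntegral.continuous_primitive (fun _ _ => hc.intervalIntegrable _ _) 0

theorem lintegral_ofReal_modulus {ω : ℝ → ℝ} (hω : IsConcaveModulus ω) (hc : Continuous ω)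
    {d : ℝ} (hd : 0 ≤ d) :
    ∫⁻ s in Set.Ioc 0 d, ENNReal.ofReal (ω s) = ENNReal.ofReal (modulusIntegral ω d) := by
  rw [modulusIntegral, intervalIntegral.integral_of_le hd, ofReal_integral_eq_lintegral_ofReal]
  · exact (hc.intervalIntegrable 0 d).1
  · filter_upwards [ae_restrict_mem measurableSet_Ioc] with s hs using hω.nonneg s hs.1.le

/-- Passing from `u` to `v` gives up the integral over `[a - v, a - u]`, where `ω ≤ ω a`, and gains
the one over `[a + u, a + v]`, of equal length, where `ω ≥ ω a`. -/
theorem modulusIntegral_sub_add_mono {ω : ℝ → ℝ} (hω : IsConcaveModulus ω) (hc : Continuous ω)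
    {a u v : ℝ} (hu : 0 ≤ u) (huv : u ≤ v) (hva : v ≤ a) :
    modulusIntegral ω (a - u) + modulusIntegral ω (a + u)
      ≤ modulusIntegral ω (a - v) + modulusIntegral ω (a + v) := by
  have hi : ∀ x y, IntervalIntegrable ω volume x y := hc.intervalIntegrable
  have h1 : modulusIntegral ω (a - u) - modulusIntegral ω (a - v)
      = ∫ s in (a - v)..(a - u), ω s :=
    intervalIntegral.integral_interval_sub_left (hi _ _) (hi _ _)
  have h2 : modulusIntegral ω (a + v) - modulusIntegral ω (a + u)
      = ∫ s in (a + u)..(a + v), ω s :=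
    intervalIntegral.integral_interval_sub_left (hi _ _) (hi _ _)
  have h3 : ∫ s in (a - v)..(a - u), ω s ≤ ∫ _ in (a - v)..(a - u), ω a :=
    intervalIntegral.integral_mono_on (by linarith) (hi _ _) intervalIntegrable_const
      fun s hs => hω.monotoneOn (Set.mem_Ici.2 (by linarith [hs.1]))
        (Set.mem_Ici.2 (by linarith)) (by linarith [hs.2])
  have h4 : ∫ _ in (a + u)..(a + v), ω a ≤ ∫ s in (a + u)..(a + v), ω s :=
    intervalIntegral.integral_mono_on (by linarith) intervalIntegrable_const (hi _ _)
      fun s hs => hω.monotoneOn (Set.mem_Ici.2 (by linarith))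
        (Set.mem_Ici.2 (by linarith [hs.1])) (by linarith [hs.1])
  simp only [intervalIntegral.integral_const, smul_eq_mul] at h3 h4
  linarith

/-! ### Increments of a process of the class -/

/-- A process on `[0, 1]`, extended to the real line by constants. -/
noncomputable def processExtension {Ω : Type*} (ξ : Set.Icc (0 : ℝ) 1 → Ω → ℝ) (x : ℝ) (w : Ω) : ℝ :=
  ξ (Set.projIcc 0 1 zero_le_one x) w

theorem integral_eq_integral_processExtension {Ω : Type*}
    (ξ : Set.Icc (0 : ℝ) 1 → Ω → ℝ) (w : Ω) :
    ∫ t, ξ t w = ∫ x in (0 : ℝ)..1, processExtension ξ x w := by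
  rw [intervalIntegral.integral_of_le zero_le_one, ← integral_Icc_eq_integral_Ioc,
    ← integral_subtype measurableSet_Icc]
  simp [processExtension]

section Increments

variable {Ω : Type*} [MeasurableSpace Ω] {P : Measure Ω} {ω : ℝ → ℝ}
  {ξ : Set.Icc (0 : ℝ) 1 → Ω → ℝ}

theorem measurable_processExtension (hξ : ξ ∈ processClass P ω) :
    Measurable (fun p : ℝ × Ω => processExtension ξ p.1 p.2) :=
  hξ.1.comp (((continuous_projIcc (h := zero_le_one' ℝ)).measurable.comp measurable_fst).prodMk measurable_snd)

/-- Clamping to `[0, 1]` is 1-Lipschitz, so times outside the interval are allowed. -/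
theorem lintegral_increment_le (hω : IsConcaveModulus ω) (hξ : ξ ∈ processClass P ω)
    {α β : Ω → ℝ} (hα : Measurable α) (hβ : Measurable β) {s : ℝ} (hs : 0 ≤ s)
    (h : ∀ᵐ w ∂P, |α w - β w| ≤ s) :
    ∫⁻ w, ‖processExtension ξ (α w) w - processExtension ξ (β w) w‖ₑ ∂P ≤ ENNReal.ofReal (ω s) := by
  refine (hξ.2 _ _ ((continuous_projIcc (h := zero_le_one' ℝ)).measurable.comp hα)
    ((continuous_projIcc (h := zero_le_one' ℝ)).measurable.comp hβ)).trans (ENNReal.ofReal_le_ofReal ?_)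
  refine hω.monotoneOn (supNorm_nonneg _ _) hs (supNorm_le hs ?_)
  filter_upwards [h] with w hw
  exact (Set.abs_projIcc_sub_projIcc zero_le_one).trans hw

/-- By Tonelli the expectation is taken first, at fixed `s`, where both endpoints are random times.
This needs `d` not to depend on the outcome. -/
theorem lintegral_lintegral_increment_le [IsProbabilityMeasure P]
    (hω : IsConcaveModulus ω) (hc : Continuous ω)
    (hξ : ξ ∈ processClass P ω) {α β : Ω → ℝ → ℝ}
    (hα : Measurable (Function.uncurry α)) (hβ : Measurable (Function.uncurry β))
    {d : ℝ} (hd : 0 ≤ d) (h : ∀ s ∈ Set.Ioc 0 d, ∀ w, |α w s - β w s| ≤ s) :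
    ∫⁻ w, (∫⁻ s in Set.Ioc 0 d,
        ‖processExtension ξ (α w s) w - processExtension ξ (β w s) w‖ₑ) ∂P
      ≤ ENNReal.ofReal (modulusIntegral ω d) := by
  have hm := measurable_processExtension hξ
  rw [lintegral_lintegral_swap, ← lintegral_ofReal_modulus hω hc hd]
  · exact setLIntegral_mono' measurableSet_Ioc fun s hs =>
      lintegral_increment_le hω hξ (hα.comp measurable_prodMk_right)
        (hβ.comp measurable_prodMk_right) hs.1.le (.of_forall (h s hs))
  · exact ((hm.comp (hα.prodMk measurable_fst)).sub
      (hm.comp (hβ.prodMk measurable_fst))).enorm.aemeasurable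

theorem measurable_lintegral_increment (hξ : ξ ∈ processClass P ω) {α β : Ω → ℝ → ℝ}
    (hα : Measurable (Function.uncurry α)) (hβ : Measurable (Function.uncurry β)) (d : ℝ) :
    Measurable fun w => ∫⁻ s in Set.Ioc 0 d,
        ‖processExtension ξ (α w s) w - processExtension ξ (β w s) w‖ₑ := by
  have hm := measurable_processExtension hξ
  exact ((hm.comp (hα.prodMk measurable_fst)).sub
      (hm.comp (hβ.prodMk measurable_fst))).enorm.lintegral_prod_right'

theorem ae_integrableOn_processExtension [IsProbabilityMeasure P]
    (hω : IsConcaveModulus ω) (hξ : ξ ∈ processClass P ω) :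
    ∀ᵐ w ∂P, IntegrableOn (fun x => processExtension ξ x w) (Set.Icc 0 1) := by
  filter_upwards [ae_integrable_path P hω hξ] with w hw
  rw [integrableOn_iff_comap_subtypeVal measurableSet_Icc]
  refine hw.congr (.of_forall fun x => ?_)
  simp [processExtension]

end Increments

/-! ### Upper bound for the error of the quadrature -/

/-- The point at distance `s` outwards from that of the extreme nodes `p`, `p + T` which is the
closer one to the boundary of `[0, 1]`. -/
noncomputable def nearPoint (T p s : ℝ) : ℝ := if p ≤ (1 - T) / 2 then p - s else p + T + s

/-- The point at distance `s` outwards from that of the extreme nodes `p`, `p + T` which is the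
farther one from the boundary of `[0, 1]`. -/
noncomputable def farPoint (T p s : ℝ) : ℝ := if p ≤ (1 - T) / 2 then p + T + s else p - s

/-- The far point at distance `s` while it lies in `[0, 1]`, and then the near point at
distance `1 - T - s`. -/
noncomputable def mixedPoint (T p s : ℝ) : ℝ :=
  if s ≤ max p (1 - T - p) then farPoint T p s else nearPoint T p (1 - T - s)

/-- The extreme node from which `mixedPoint T p s` is measured. -/
noncomputable def mixedBase (T p s : ℝ) : ℝ :=
  if s ≤ max p (1 - T - p) then farPoint T p 0 else nearPoint T p 0

theorem measurable_nearPoint {δ : Type*} [MeasurableSpace δ] (T : ℝ) {p s : δ → ℝ}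
    (hp : Measurable p) (hs : Measurable s) : Measurable fun x => nearPoint T (p x) (s x) :=
  Measurable.ite (measurableSet_le hp measurable_const) (hp.sub hs)
    ((hp.add measurable_const).add hs)

theorem measurable_farPoint {δ : Type*} [MeasurableSpace δ] (T : ℝ) {p s : δ → ℝ}
    (hp : Measurable p) (hs : Measurable s) : Measurable fun x => farPoint T (p x) (s x) :=
  Measurable.ite (measurableSet_le hp measurable_const) ((hp.add measurable_const).add hs)
    (hp.sub hs)

theorem measurable_mixedPoint {δ : Type*} [MeasurableSpace δ] (T : ℝ) {p s : δ → ℝ}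
    (hp : Measurable p) (hs : Measurable s) : Measurable fun x => mixedPoint T (p x) (s x) :=
  Measurable.ite (measurableSet_le hs (hp.max (measurable_const.sub hp)))
    (measurable_farPoint T hp hs) (measurable_nearPoint T hp (measurable_const.sub hs))

theorem measurable_mixedBase {δ : Type*} [MeasurableSpace δ] (T : ℝ) {p s : δ → ℝ}
    (hp : Measurable p) (hs : Measurable s) : Measurable fun x => mixedBase T (p x) (s x) :=
  Measurable.ite (measurableSet_le hs (hp.max (measurable_const.sub hp)))
    (measurable_farPoint T hp measurable_const) (measurable_nearPoint T hp measurable_const)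

theorem abs_nearPoint_sub (T p s : ℝ) : |nearPoint T p s - nearPoint T p 0| = |s| := by
  unfold nearPoint
  split_ifs
  · rw [show p - s - (p - 0) = -s by ring, abs_neg]
  · rw [show p + T + s - (p + T + 0) = s by ring]

theorem abs_farPoint_sub (T p s : ℝ) : |farPoint T p s - farPoint T p 0| = |s| := by
  unfold farPoint
  split_ifs
  · rw [show p + T + s - (p + T + 0) = s by ring]
  · rw [show p - s - (p - 0) = -s by ring, abs_neg]

/-- Past the switch `s` exceeds both `p` and `1 - T - p`, hence `1 - T - s < s`: the reflected
increments are shorter than the slot they fill. -/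
theorem abs_mixedPoint_sub_le {T p s : ℝ} (hs : 0 ≤ s) (hsT : s ≤ 1 - T) :
    |mixedPoint T p s - mixedBase T p s| ≤ s := by
  unfold mixedPoint mixedBase
  split_ifs with h
  · rw [abs_farPoint_sub, abs_of_nonneg hs]
  · rw [abs_nearPoint_sub, abs_of_nonneg (by linarith)]
    rw [not_le, max_lt_iff] at h
    linarith

/-- The rearrangement is applied with the shorter end interval as `q`, `r = (1 - T) / 2 - u` and
total length `b = 1 - T`. It replaces the random limits of integration by ones free of `p`. -/
theorem lintegral_end_increments_le {f : ℝ → ℝ} {T p u : ℝ} (hu : u ≤ (1 - T) / 2)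
    (hp : |p - (1 - T) / 2| ≤ u) :
    (∫⁻ s in Set.Ioc 0 p, ‖f (p - s) - f p‖ₑ)
        + (∫⁻ s in Set.Ioc 0 (1 - T - p), ‖f (p + T + s) - f (p + T)‖ₑ)
      ≤ (∫⁻ s in Set.Ioc 0 ((1 - T) / 2 - u), ‖f (nearPoint T p s) - f (nearPoint T p 0)‖ₑ)
        + ∫⁻ s in Set.Ioc 0 ((1 - T) / 2 + u),
          ‖f (mixedPoint T p s) - f (mixedBase T p s)‖ₑ := by
  rw [abs_le] at hp
  have hb : (1 - T) / 2 + u = (1 - T) - ((1 - T) / 2 - u) := by ring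
  by_cases h : p ≤ (1 - T) / 2
  · have := lintegral_Ioc_add_le_rearrange (N := fun s => ‖f (p - s) - f p‖ₑ)
      (F := fun s => ‖f (p + T + s) - f (p + T)‖ₑ) (r := (1 - T) / 2 - u) (q := p) (b := 1 - T)
      (by linarith) (by linarith) (by linarith)
    have hmax : max p (1 - T - p) = 1 - T - p := max_eq_right (by linarith)
    rw [hb]
    refine this.trans (le_of_eq ?_)
    congr 1
    · simp [nearPoint, h]
    · refine lintegral_congr fun s => ?_
      simp only [mixedPoint, mixedBase, hmax]
      split_ifs <;> simp [nearPoint, farPoint, h]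
  · have := lintegral_Ioc_add_le_rearrange (N := fun s => ‖f (p + T + s) - f (p + T)‖ₑ)
      (F := fun s => ‖f (p - s) - f p‖ₑ) (r := (1 - T) / 2 - u) (q := 1 - T - p) (b := 1 - T)
      (by linarith) (by linarith) (by linarith)
    have hmax : max p (1 - T - p) = p := max_eq_left (by linarith)
    rw [hb, add_comm]
    rw [sub_sub_cancel] at this
    refine this.trans (le_of_eq ?_)
    congr 1
    · simp [nearPoint, h]
    · refine lintegral_congr fun s => ?_
      simp only [mixedPoint, mixedBase, hmax]
      split_ifs <;> simp [nearPoint, farPoint, h]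

section Upper

variable {Ω : Type*} [MeasurableSpace Ω] {P : Measure Ω} [IsProbabilityMeasure P] {ω : ℝ → ℝ}
  {m : ℕ} {t : Fin (m + 1) → ℝ} {τ : Ω → Set.Icc (0 : ℝ) 1}

theorem lintegral_sum_cell_increments_le (hω : IsConcaveModulus ω) (hc : Continuous ω)
    (ht : Monotone t) (hτ : Measurable τ) {ξ : Set.Icc (0 : ℝ) 1 → Ω → ℝ}
    (hξ : ξ ∈ processClass P ω) :
    ∫⁻ w, (∑ k : Fin m, ((∫⁻ s in Set.Ioc 0 ((t k.succ - t k.castSucc) / 2),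
          ‖processExtension ξ (τ w + t k.castSucc + s) w - processExtension ξ (τ w + t k.castSucc) w‖ₑ)
        + ∫⁻ s in Set.Ioc 0 ((t k.succ - t k.castSucc) / 2),
          ‖processExtension ξ (τ w + t k.succ - s) w - processExtension ξ (τ w + t k.succ) w‖ₑ)) ∂P
      ≤ ENNReal.ofReal (2 * ∑ k : Fin m, modulusIntegral ω ((t k.succ - t k.castSucc) / 2)) := by
  have hp : Measurable fun w => (τ w : ℝ) := measurable_subtype_coe.comp hτ
  have hbase : ∀ k, Measurable (Function.uncurry fun (w : Ω) (_ : ℝ) => (τ w : ℝ) + t k) :=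
    fun k => (hp.comp measurable_fst).add measurable_const
  have hright : ∀ k, Measurable (Function.uncurry fun (w : Ω) (s : ℝ) => (τ w : ℝ) + t k + s) :=
    fun k => (hbase k).add measurable_snd
  have hleft : ∀ k, Measurable (Function.uncurry fun (w : Ω) (s : ℝ) => (τ w : ℝ) + t k - s) :=
    fun k => (hbase k).sub measurable_snd
  have hlen : ∀ k : Fin m, 0 ≤ (t k.succ - t k.castSucc) / 2 := fun k => by
    have := ht (Fin.castSucc_le_succ k)
    linarith
  rw [lintegral_finsetSum _ fun k _ => (measurable_lintegral_increment hξ (hright k.castSucc)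
    (hbase k.castSucc) _).add (measurable_lintegral_increment hξ (hleft k.succ) (hbase k.succ) _),
    Finset.mul_sum, ENNReal.ofReal_sum_of_nonneg fun k _ =>
      mul_nonneg zero_le_two (modulusIntegral_nonneg hω (hlen k))]
  refine Finset.sum_le_sum fun k _ => ?_
  rw [lintegral_add_left (measurable_lintegral_increment hξ (hright k.castSucc)
    (hbase k.castSucc) _), two_mul, ENNReal.ofReal_add (modulusIntegral_nonneg hω (hlen k))
      (modulusIntegral_nonneg hω (hlen k))]
  refine add_le_add ?_ ?_
  · refine lintegral_lintegral_increment_le hω hc hξ (hright _) (hbase _) (hlen k) fun s hs w => ?_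
    rw [add_sub_cancel_left, abs_of_pos hs.1]
  · refine lintegral_lintegral_increment_le hω hc hξ (hleft _) (hbase _) (hlen k) fun s hs w => ?_
    rw [sub_sub_cancel_left, abs_neg, abs_of_pos hs.1]

theorem lintegral_end_increments_process_le (hω : IsConcaveModulus ω) (hc : Continuous ω)
    (hτ : Measurable τ) {ξ : Set.Icc (0 : ℝ) 1 → Ω → ℝ} (hξ : ξ ∈ processClass P ω)
    {T u : ℝ} (hu0 : 0 ≤ u) (hu : u ≤ (1 - T) / 2)
    (hτu : ∀ᵐ w ∂P, |(τ w : ℝ) - (1 - T) / 2| ≤ u) :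
    ∫⁻ w, ((∫⁻ s in Set.Ioc 0 (τ w : ℝ),
          ‖processExtension ξ (τ w - s) w - processExtension ξ (τ w) w‖ₑ)
        + ∫⁻ s in Set.Ioc 0 (1 - T - τ w),
          ‖processExtension ξ (τ w + T + s) w - processExtension ξ (τ w + T) w‖ₑ) ∂P
      ≤ ENNReal.ofReal (modulusIntegral ω ((1 - T) / 2 - u)
        + modulusIntegral ω ((1 - T) / 2 + u)) := by
  have hp : Measurable fun w => (τ w : ℝ) := measurable_subtype_coe.comp hτ
  have hp' : Measurable fun x : Ω × ℝ => (τ x.1 : ℝ) := hp.comp measurable_fst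
  have hN : Measurable (Function.uncurry fun w s => nearPoint T (τ w) s) :=
    measurable_nearPoint T hp' measurable_snd
  have hN0 : Measurable (Function.uncurry fun w (_ : ℝ) => nearPoint T (τ w) 0) :=
    measurable_nearPoint T hp' measurable_const
  have hV : Measurable (Function.uncurry fun w s => mixedPoint T (τ w) s) :=
    measurable_mixedPoint T hp' measurable_snd
  have hV0 : Measurable (Function.uncurry fun w s => mixedBase T (τ w) s) :=
    measurable_mixedBase T hp' measurable_snd
  refine (lintegral_mono_ae ?_).trans ((lintegral_add_left
    (measurable_lintegral_increment hξ hN hN0 ((1 - T) / 2 - u))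
    fun w => ∫⁻ s in Set.Ioc 0 ((1 - T) / 2 + u), ‖processExtension ξ (mixedPoint T (τ w) s) w
      - processExtension ξ (mixedBase T (τ w) s) w‖ₑ).trans_le ?_)
  · filter_upwards [hτu] with w hw
    exact lintegral_end_increments_le (f := fun x => processExtension ξ x w) hu hw
  · rw [ENNReal.ofReal_add (modulusIntegral_nonneg hω (by linarith))
      (modulusIntegral_nonneg hω (by linarith))]
    refine add_le_add ?_ ?_
    · refine lintegral_lintegral_increment_le hω hc hξ hN hN0 (by linarith) fun s hs w => ?_
      rw [abs_nearPoint_sub, abs_of_pos hs.1]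
    · refine lintegral_lintegral_increment_le hω hc hξ hV hV0 (by linarith) fun s hs w => ?_
      exact abs_mixedPoint_sub_le hs.1.le (by linarith [hs.2])

theorem recoveryError_optimalQuadrature_le (hω : IsConcaveModulus ω) (hc : Continuous ω)
    (ht0 : t 0 = 0) (ht : Monotone t) (hτ : Measurable τ)
    {τs : Fin (m + 1) → Ω → Set.Icc (0 : ℝ) 1}
    (hτs_eq : ∀ k, ∀ᵐ w ∂P, (τs k w : ℝ) = (τ w : ℝ) + t k)
    {u : ℝ} (hu0 : 0 ≤ u) (hu : u ≤ (1 - t (Fin.last m)) / 2)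
    (hτu : ∀ᵐ w ∂P, |(τ w : ℝ) - (1 - t (Fin.last m)) / 2| ≤ u) :
    recoveryError P ω τs (optimalQuadrature τ t) ≤ ENNReal.ofReal
        (2 * ∑ k : Fin m, modulusIntegral ω ((t k.succ - t k.castSucc) / 2)
          + modulusIntegral ω ((1 - t (Fin.last m)) / 2 - u)
          + modulusIntegral ω ((1 - t (Fin.last m)) / 2 + u)) := by
  refine iSup₂_le fun ξ hξ => ?_
  have hp : Measurable fun w => (τ w : ℝ) := measurable_subtype_coe.comp hτ
  have hbase : ∀ k, Measurable (Function.uncurry fun (w : Ω) (_ : ℝ) => (τ w : ℝ) + t k) :=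
    fun k => (hp.comp measurable_fst).add measurable_const
  have hright : ∀ k, Measurable (Function.uncurry fun (w : Ω) (s : ℝ) => (τ w : ℝ) + t k + s) :=
    fun k => (hbase k).add measurable_snd
  have hleft : ∀ k, Measurable (Function.uncurry fun (w : Ω) (s : ℝ) => (τ w : ℝ) + t k - s) :=
    fun k => (hbase k).sub measurable_snd
  have hsum0 : 0 ≤ 2 * ∑ k : Fin m, modulusIntegral ω ((t k.succ - t k.castSucc) / 2) :=
    mul_nonneg zero_le_two (Finset.sum_nonneg fun k _ => modulusIntegral_nonneg hω (by
      have := ht (Fin.castSucc_le_succ k)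
      linarith))
  rw [add_assoc, ENNReal.ofReal_add hsum0 (add_nonneg (modulusIntegral_nonneg hω (by linarith))
    (modulusIntegral_nonneg hω (by linarith)))]
  refine (lintegral_mono_ae ?_).trans ((lintegral_add_left ?_ _).trans_le (add_le_add
    (lintegral_sum_cell_increments_le hω hc ht hτ hξ)
    (lintegral_end_increments_process_le hω hc hτ hξ hu0 hu hτu)))
  · filter_upwards [ae_all_iff.2 hτs_eq, ae_integrableOn_processExtension hω hξ] with w hw hint
    have hnode : ∀ k, ξ (τs k w) w = processExtension ξ (τ w + t k) w := fun k => by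
      rw [← hw k, processExtension, Set.projIcc_val]
    have hle : (τ w : ℝ) + t (Fin.last m) ≤ 1 := hw (Fin.last m) ▸ (τs (Fin.last m) w).2.2
    have := enorm_quadrature_error_le hint ht0 ht (τ w).2.1 hle
    rw [optimalQuadrature, sum_optimalWeight_mul τ t ht0, integral_eq_integral_processExtension]
    simp only [hnode]
    rw [ht0, add_zero]
    exact this
  · exact Finset.measurable_sum _ fun k _ => (measurable_lintegral_increment hξ
      (hright k.castSucc) (hbase k.castSucc) _).add
      (measurable_lintegral_increment hξ (hleft k.succ) (hbase k.succ) _)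

end Upper

/-! ### Lower bound for the error of an arbitrary method -/

/-- The distance from `y` to the closest of the nodes `x k`. -/
noncomputable def nodeDist {m : ℕ} (x : Fin (m + 1) → ℝ) (y : ℝ) : ℝ :=
  Finset.univ.inf' Finset.univ_nonempty fun k => |y - x k|

section NodeDist

variable {m : ℕ} {x : Fin (m + 1) → ℝ}

theorem le_nodeDist_iff {y s : ℝ} : s ≤ nodeDist x y ↔ ∀ k, s ≤ |y - x k| := by
  simp [nodeDist]

theorem nodeDist_nonneg (x : Fin (m + 1) → ℝ) (y : ℝ) : 0 ≤ nodeDist x y :=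
  le_nodeDist_iff.2 fun _ => abs_nonneg _

theorem nodeDist_le (x : Fin (m + 1) → ℝ) (y : ℝ) (k : Fin (m + 1)) : nodeDist x y ≤ |y - x k| :=
  le_nodeDist_iff.1 le_rfl k

theorem nodeDist_node (x : Fin (m + 1) → ℝ) (k : Fin (m + 1)) : nodeDist x (x k) = 0 :=
  le_antisymm ((nodeDist_le x _ k).trans (by simp)) (nodeDist_nonneg x _)

theorem abs_nodeDist_sub_le (x : Fin (m + 1) → ℝ) (y z : ℝ) :
    |nodeDist x y - nodeDist x z| ≤ |y - z| := by
  have key : ∀ y z, nodeDist x y - |y - z| ≤ nodeDist x z := fun y z =>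
    le_nodeDist_iff.2 fun k => by
      have := nodeDist_le x y k
      have := abs_sub_le y z (x k)
      linarith
  rw [_root_.abs_sub_le_iff]
  have := key y z
  have h := key z y
  rw [abs_sub_comm] at h
  constructor <;> linarith

theorem continuous_nodeDist (x : Fin (m + 1) → ℝ) : Continuous (nodeDist x) :=
  (LipschitzWith.of_dist_le_mul (K := 1) fun y z => by
    simpa [Real.dist_eq] using abs_nodeDist_sub_le x y z).continuous

theorem measurable_nodeDist {δ : Type*} [MeasurableSpace δ] {x : Fin (m + 1) → δ → ℝ}
    (hx : ∀ k, Measurable (x k)) {y : δ → ℝ} (hy : Measurable y) :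
    Measurable fun a => nodeDist (fun k => x k a) (y a) := by
  have h : ∀ k, Measurable fun a => |y a - x k a| := fun k =>
    continuous_abs.measurable.comp (hy.sub (hx k))
  have hinf : Measurable (Finset.univ.inf' Finset.univ_nonempty fun k a => |y a - x k a|) :=
    Finset.inf'_induction _ _ (fun _ hf _ hg => hf.inf hg) fun k _ => h k
  convert hinf using 1
  ext a
  rw [Finset.inf'_apply, nodeDist]

/-- Nodes up to `k` are at distance at least `s` on the left; later ones are at least the gap minus
`s` away, which is no less than `s` up to the midpoint. -/
theorem le_nodeDist_right (hx : Monotone x) {k : Fin m} {s : ℝ}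
    (hsk : s ≤ (x k.succ - x k.castSucc) / 2) : s ≤ nodeDist x (x k.castSucc + s) := by
  refine le_nodeDist_iff.2 fun j => ?_
  rcases le_or_gt j k.castSucc with h | h
  · have := hx h
    exact le_trans (by linarith) (le_abs_self _)
  · have := hx (Fin.castSucc_lt_iff_succ_le.1 h)
    exact le_trans (by linarith) (neg_le_abs _)

theorem le_nodeDist_left (hx : Monotone x) {k : Fin m} {s : ℝ}
    (hsk : s ≤ (x k.succ - x k.castSucc) / 2) : s ≤ nodeDist x (x k.succ - s) := by
  refine le_nodeDist_iff.2 fun j => ?_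
  rcases le_or_gt j k.castSucc with h | h
  · have := hx h
    exact le_trans (by linarith) (le_abs_self _)
  · have := hx (Fin.castSucc_lt_iff_succ_le.1 h)
    exact le_trans (by linarith) (neg_le_abs _)

theorem le_nodeDist_zero (hx : Monotone x) (s : ℝ) : s ≤ nodeDist x (x 0 - s) := by
  refine le_nodeDist_iff.2 fun j => ?_
  have := hx (Fin.zero_le j)
  exact le_trans (by linarith) (neg_le_abs _)

theorem le_nodeDist_last (hx : Monotone x) (s : ℝ) : s ≤ nodeDist x (x (Fin.last m) + s) := by
  refine le_nodeDist_iff.2 fun j => ?_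
  have := hx (Fin.le_last j)
  exact le_trans (by linarith) (le_abs_self _)

end NodeDist

section Modulus

variable {ω : ℝ → ℝ}

theorem modulusIntegral_le_integral_left (hω : IsConcaveModulus ω) (hc : Continuous ω)
    {g : ℝ → ℝ} (hg : Continuous g) {c d : ℝ} (hd : 0 ≤ d)
    (h : ∀ s, 0 ≤ s → s ≤ d → s ≤ g (c - s)) :
    modulusIntegral ω d ≤ ∫ y in (c - d)..c, ω (g y) := by
  have h1 : ∫ y in (c - d)..c, ω (g y) = ∫ s in (0 : ℝ)..d, ω (g (c - s)) := by
    rw [intervalIntegral.integral_comp_sub_left (fun y => ω (g y))]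
    simp
  rw [h1]
  refine intervalIntegral.integral_mono_on hd (hc.intervalIntegrable _ _)
    (Continuous.intervalIntegrable (by fun_prop) _ _) fun s hs => ?_
  have := h s hs.1 hs.2
  exact hω.monotoneOn hs.1 (hs.1.trans this) this

theorem modulusIntegral_le_integral_right (hω : IsConcaveModulus ω) (hc : Continuous ω)
    {g : ℝ → ℝ} (hg : Continuous g) {c d : ℝ} (hd : 0 ≤ d)
    (h : ∀ s, 0 ≤ s → s ≤ d → s ≤ g (c + s)) :
    modulusIntegral ω d ≤ ∫ y in c..(c + d), ω (g y) := by
  have h1 : ∫ y in c..(c + d), ω (g y) = ∫ s in (0 : ℝ)..d, ω (g (c + s)) := by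
    rw [intervalIntegral.integral_comp_add_left (fun y => ω (g y))]
    simp
  rw [h1]
  refine intervalIntegral.integral_mono_on hd (hc.intervalIntegrable _ _)
    (Continuous.intervalIntegrable (by fun_prop) _ _) fun s hs => ?_
  have := h s hs.1 hs.2
  exact hω.monotoneOn hs.1 (hs.1.trans this) this

/-- On each half-cell the nearest node is no closer than the cell's own node, and `ω` is
non-decreasing. -/
theorem sum_modulusIntegral_le_integral_nodeDist (hω : IsConcaveModulus ω) (hc : Continuous ω)
    {m : ℕ} {t : Fin (m + 1) → ℝ} (ht0 : t 0 = 0) (ht : Monotone t) {p : ℝ} (hp : 0 ≤ p)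
    (hp1 : p + t (Fin.last m) ≤ 1) :
    2 * ∑ k : Fin m, modulusIntegral ω ((t k.succ - t k.castSucc) / 2)
        + (modulusIntegral ω p + modulusIntegral ω (1 - t (Fin.last m) - p))
      ≤ ∫ y in (0 : ℝ)..1, ω (nodeDist (fun k => p + t k) y) := by
  have hx : Monotone fun k => p + t k := ht.const_add p
  have hg := continuous_nodeDist fun k => p + t k
  have hlen : ∀ k : Fin m, 0 ≤ (t k.succ - t k.castSucc) / 2 := fun k => by
    have := ht (Fin.castSucc_le_succ k)
    linarith
  rw [integral_eq_sum_integral_cells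
    (f := fun y => ω (nodeDist (fun k => p + t k) y)) (hc.comp hg).integrableOn_Icc ht0 ht hp hp1, Finset.mul_sum]
  have h1 := modulusIntegral_le_integral_left hω hc hg hp (c := p) fun s _ _ => by
    simpa [ht0] using le_nodeDist_zero hx s
  have h2 := modulusIntegral_le_integral_right hω hc hg (c := p + t (Fin.last m))
    (d := 1 - t (Fin.last m) - p) (by linarith) fun s _ _ => le_nodeDist_last hx s
  have h3 := Finset.sum_le_sum fun (k : Fin m) (_ : k ∈ Finset.univ) =>
    add_le_add
      (modulusIntegral_le_integral_right hω hc hg (c := p + t k.castSucc) (hlen k)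
        fun s _ hsk => le_nodeDist_right hx (by simpa using hsk))
      (modulusIntegral_le_integral_left hω hc hg (c := p + t k.succ) (hlen k)
        fun s _ hsk => le_nodeDist_left hx (by simpa using hsk))
  simp only [← two_mul] at h3
  linarith

end Modulus

/-! ### The extremal process and indistinguishable data. -/

section Lower

variable {Ω : Type*} [MeasurableSpace Ω] {P : Measure Ω} {ω : ℝ → ℝ} {m : ℕ}
  {τs : Fin (m + 1) → Ω → Set.Icc (0 : ℝ) 1}

theorem neg_mem_processClass {ξ : Set.Icc (0 : ℝ) 1 → Ω → ℝ} (hξ : ξ ∈ processClass P ω) :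
    (fun y w => -ξ y w) ∈ processClass P ω := by
  refine ⟨hξ.1.neg, fun τ θ hτ hθ => ?_⟩
  refine le_trans (le_of_eq (lintegral_congr fun w => ?_)) (hξ.2 τ θ hτ hθ)
  rw [← neg_sub', enorm_neg]

/-- Methods cannot distinguish between `ξ` and `-ξ` if `ξ` vanishes at the nodes. -/
theorem lintegral_enorm_integral_le_recoveryError {ξ : Set.Icc (0 : ℝ) 1 → Ω → ℝ}
    (hξ : ξ ∈ processClass P ω) (hξ0 : ∀ k w, ξ (τs k w) w = 0)
    {φ : (Fin (m + 1) → Ω → ℝ) → Ω → ℝ} (hφ : IsRecoveryMethod φ) :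
    ∫⁻ w, ‖∫ y, ξ y w‖ₑ ∂P ≤ recoveryError P ω τs φ := by
  have hS : Measurable fun w => ∫ y, ξ y w :=
    (hξ.1.stronglyMeasurable.integral_prod_left' (μ := volume)).measurable
  have hz : Measurable (φ fun _ _ => 0) := hφ _ fun _ => measurable_const
  have h1 : ∫⁻ w, ‖(∫ y, ξ y w) - φ (fun _ _ => 0) w‖ₑ ∂P ≤ recoveryError P ω τs φ := by
    refine le_trans (le_of_eq ?_) (le_iSup₂ ξ hξ)
    simp only [hξ0]
  have h2 : ∫⁻ w, ‖-(∫ y, ξ y w) - φ (fun _ _ => 0) w‖ₑ ∂P ≤ recoveryError P ω τs φ := by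
    refine le_trans (le_of_eq ?_) (le_iSup₂ _ (neg_mem_processClass hξ))
    simp only [hξ0, neg_zero, integral_neg]
  have h3 : 2 * ∫⁻ w, ‖∫ y, ξ y w‖ₑ ∂P ≤ 2 * recoveryError P ω τs φ := by
    rw [two_mul (recoveryError P ω τs φ), ← lintegral_const_mul _ hS.enorm]
    refine le_trans ?_ (add_le_add h1 h2)
    refine (lintegral_mono fun w => ?_).trans (lintegral_add_left (hS.sub hz).enorm _).le
    simp only [Pi.sub_apply]
    have h := enorm_sub_le (a := (∫ y, ξ y w) - φ (fun _ _ => 0) w)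
      (b := -(∫ y, ξ y w) - φ (fun _ _ => 0) w)
    refine le_trans (le_of_eq ?_) h
    rw [show (∫ y, ξ y w) - φ (fun _ _ => 0) w - (-(∫ y, ξ y w) - φ (fun _ _ => 0) w)
      = 2 * ∫ y, ξ y w by ring, enorm_mul]
    simp [enorm_eq_nnnorm]
  exact (ENNReal.mul_le_mul_iff_right two_ne_zero ENNReal.ofNat_ne_top).1 h3

/-- The process `ω (min_k |y - τ_k|)`, concentrated on the event `A`. -/
noncomputable def extremalPath (P : Measure Ω) (ω : ℝ → ℝ)
    (τs : Fin (m + 1) → Ω → Set.Icc (0 : ℝ) 1) (A : Set Ω) (y : Set.Icc (0 : ℝ) 1) (w : Ω) : ℝ :=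
  A.indicator (fun w => (P A).toReal⁻¹ * ω (nodeDist (fun k => (τs k w : ℝ)) y)) w

theorem extremalPath_node (hω : IsConcaveModulus ω) (A : Set Ω) (k : Fin (m + 1)) (w : Ω) :
    extremalPath P ω τs A (τs k w) w = 0 := by
  have : nodeDist (fun k => (τs k w : ℝ)) (τs k w) = 0 := nodeDist_node _ k
  simp [extremalPath, Set.indicator, this, hω.map_zero]

theorem enorm_inv_measure_mul [IsProbabilityMeasure P] {A : Set Ω} (hA : P A ≠ 0) :
    ‖(P A).toReal⁻¹‖ₑ * P A = 1 := by
  have hpos : 0 < (P A).toReal := ENNReal.toReal_pos hA (measure_ne_top P A)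
  rw [Real.enorm_eq_ofReal (inv_nonneg.2 hpos.le), ENNReal.ofReal_inv_of_pos hpos,
    ENNReal.ofReal_toReal (measure_ne_top P A)]
  exact ENNReal.inv_mul_cancel hA (measure_ne_top P A)

/-- Each path inherits the modulus, since the distance to the nodes is 1-Lipschitz and `|ω x - ω y|
≤ ω |x - y|`. The factor `1 / P A` is exactly offset by the mass of `A`. -/
theorem extremalPath_mem [IsProbabilityMeasure P] (hω : IsConcaveModulus ω)
    (hc : Continuous ω) (hτs : ∀ k, Measurable (τs k)) {A : Set Ω} (hAm : MeasurableSet A)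
    (hA : P A ≠ 0) : extremalPath P ω τs A ∈ processClass P ω := by
  refine ⟨?_, fun τ θ hτ hθ => ?_⟩
  · have h1 : Measurable fun p : Set.Icc (0 : ℝ) 1 × Ω =>
        (P A).toReal⁻¹ * ω (nodeDist (fun k => (τs k p.2 : ℝ)) p.1) :=
      (hc.measurable.comp (measurable_nodeDist
        (fun k => measurable_subtype_coe.comp ((hτs k).comp measurable_snd))
        (measurable_subtype_coe.comp measurable_fst))).const_mul _
    exact h1.indicator (measurable_snd hAm)
  · have hbd : ∀ᵐ w ∂P, |(τ w : ℝ) - θ w| ≤ 1 := .of_forall fun w => by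
      have h1 := (τ w).2
      have h2 := (θ w).2
      rw [abs_le]
      constructor <;> linarith [h1.1, h1.2, h2.1, h2.2]
    set s := supNorm P fun w => (τ w : ℝ) - θ w with hs
    calc ∫⁻ w, ‖extremalPath P ω τs A (τ w) w - extremalPath P ω τs A (θ w) w‖ₑ ∂P
        ≤ ∫⁻ w, A.indicator (fun _ => ‖(P A).toReal⁻¹‖ₑ * ENNReal.ofReal (ω s)) w ∂P := by
          refine lintegral_mono_ae ?_
          filter_upwards [ae_abs_le_supNorm hbd] with w hw
          by_cases hwA : w ∈ A
          · simp only [extremalPath, Set.indicator_of_mem hwA]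
            rw [← mul_sub, enorm_mul]
            gcongr
            rw [← ofReal_norm, Real.norm_eq_abs]
            refine ENNReal.ofReal_le_ofReal ((hω.abs_sub_le (nodeDist_nonneg _ _)
              (nodeDist_nonneg _ _)).trans ?_)
            exact hω.monotoneOn (Set.mem_Ici.2 (abs_nonneg _)) (supNorm_nonneg _ _)
              ((abs_nodeDist_sub_le _ _ _).trans hw)
          · simp [extremalPath, hwA]
      _ = ENNReal.ofReal (ω s) := by
          rw [lintegral_indicator_const hAm, mul_right_comm, enorm_inv_measure_mul hA, one_mul]

theorem le_lintegral_enorm_integral_extremalPath [IsProbabilityMeasure P]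
    {A : Set Ω} (hAm : MeasurableSet A) (hA : P A ≠ 0) {l : ℝ}
    (hl : ∀ᵐ w ∂P, w ∈ A →
      l ≤ ∫ y in (0 : ℝ)..1, ω (nodeDist (fun k => (τs k w : ℝ)) y)) :
    ENNReal.ofReal l ≤ ∫⁻ w, ‖∫ y, extremalPath P ω τs A y w‖ₑ ∂P := by
  calc ENNReal.ofReal l
      = ∫⁻ w, A.indicator (fun _ => ‖(P A).toReal⁻¹‖ₑ * ENNReal.ofReal l) w ∂P := by
        rw [lintegral_indicator_const hAm, mul_right_comm, enorm_inv_measure_mul hA, one_mul]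
    _ ≤ _ := by
        refine lintegral_mono_ae ?_
        filter_upwards [hl] with w hw
        by_cases hwA : w ∈ A
        · simp only [extremalPath, Set.indicator_of_mem hwA]
          rw [integral_const_mul, enorm_mul]
          gcongr
          rw [← ofReal_norm, Real.norm_eq_abs]
          refine ENNReal.ofReal_le_ofReal ((hw hwA).trans ?_)
          rw [intervalIntegral.integral_of_le zero_le_one, ← integral_Icc_eq_integral_Ioc,
            ← integral_subtype measurableSet_Icc]
          exact le_abs_self _
        · simp [hwA]

/-- Concentrating on outcomes where `τ` is nearly as far from the centre as possible costs nothing,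
however small their probability. The truncation `max r 0` covers negative `r`, the only choice when
the norm is zero. -/
theorem le_optimalError_of_lt [IsProbabilityMeasure P] (hω : IsConcaveModulus ω)
    (hc : Continuous ω) {t : Fin (m + 1) → ℝ} (ht0 : t 0 = 0) (ht : Monotone t)
    {τ : Ω → Set.Icc (0 : ℝ) 1} (hτ : Measurable τ) (hτs : ∀ k, Measurable (τs k))
    (hτs_eq : ∀ k, ∀ᵐ w ∂P, (τs k w : ℝ) = (τ w : ℝ) + t k) {r : ℝ}
    (hr : r < supNorm P (fun w => (τ w : ℝ) - (1 - t (Fin.last m)) / 2)) :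
    ENNReal.ofReal (2 * ∑ k : Fin m, modulusIntegral ω ((t k.succ - t k.castSucc) / 2)
        + modulusIntegral ω ((1 - t (Fin.last m)) / 2 - max r 0)
        + modulusIntegral ω ((1 - t (Fin.last m)) / 2 + max r 0))
      ≤ optimalError P ω τs := by
  set a := (1 - t (Fin.last m)) / 2 with ha
  set A : Set Ω := {w | r < |(τ w : ℝ) - a|} with hAdef
  have hAm : MeasurableSet A := measurableSet_lt measurable_const
    (continuous_abs.measurable.comp ((measurable_subtype_coe.comp hτ).sub measurable_const))
  -- If `A` were null, `r` would be an essential bound; a single outcome satisfying it shows `0 ≤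
  -- r`, which `supNorm_le` requires.
  have hA : P A ≠ 0 := fun h0 => by
    have h1 : ∀ᵐ w ∂P, |(τ w : ℝ) - a| ≤ r := by
      filter_upwards [measure_eq_zero_iff_ae_notMem.1 h0] with w hw using not_lt.1 hw
    obtain ⟨w, hw⟩ := h1.exists
    exact absurd (supNorm_le ((abs_nonneg _).trans hw) h1) (not_le.2 hr)
  refine le_iInf₂ fun φ hφ => ?_
  refine (le_lintegral_enorm_integral_extremalPath (ω := ω) (τs := τs) hAm hA ?_).trans
    (lintegral_enorm_integral_le_recoveryError (extremalPath_mem hω hc hτs hAm hA)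
      (extremalPath_node hω A) hφ)
  filter_upwards [ae_all_iff.2 hτs_eq] with w hw hwA
  have h0 : 0 ≤ (τ w : ℝ) := (τ w).2.1
  have h1 : (τ w : ℝ) + t (Fin.last m) ≤ 1 := hw (Fin.last m) ▸ (τs (Fin.last m) w).2.2
  have h2 := sum_modulusIntegral_le_integral_nodeDist hω hc ht0 ht h0 h1
  simp only [hw]
  have habs : |(τ w : ℝ) - a| ≤ a := by
    rw [abs_le]
    constructor <;> linarith
  have h3 := modulusIntegral_sub_add_mono hω hc (a := a) (le_max_right r 0)
    (max_le (le_of_lt hwA) (abs_nonneg ((τ w : ℝ) - a))) habs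
  -- The numbers `a ∓ |τ - a|` are the lengths of the two end intervals, in increasing order.
  have h4 : modulusIntegral ω (a - |(τ w : ℝ) - a|) + modulusIntegral ω (a + |(τ w : ℝ) - a|)
      = modulusIntegral ω (τ w) + modulusIntegral ω (1 - t (Fin.last m) - τ w) := by
    rcases abs_cases ((τ w : ℝ) - a) with ⟨h, _⟩ | ⟨h, _⟩ <;> rw [h]
    · rw [add_comm]
      congr 2 <;> rw [ha] <;> ring
    · congr 2 <;> rw [ha] <;> ring
  linarith

end Lower

/-! ### Admissibility of the quadrature and the final equality. -/

theorem measurable_optimalWeight {Ω : Type*} [MeasurableSpace Ω] {m : ℕ}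
    {τ : Ω → Set.Icc (0 : ℝ) 1} (hτ : Measurable τ) (t : Fin (m + 1) → ℝ) (k : Fin (m + 1)) :
    Measurable (optimalWeight τ t k) := by
  have hp : Measurable fun w => (τ w : ℝ) := measurable_subtype_coe.comp hτ
  unfold optimalWeight
  split_ifs
  · exact measurable_const
  · exact hp.add measurable_const
  · exact (measurable_const.sub hp).sub measurable_const
  · exact measurable_const

theorem isRecoveryMethod_optimalQuadrature {Ω : Type*} [MeasurableSpace Ω] {m : ℕ}
    {τ : Ω → Set.Icc (0 : ℝ) 1} (hτ : Measurable τ) (t : Fin (m + 1) → ℝ) :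
    IsRecoveryMethod (optimalQuadrature τ t) := fun _ hx =>
  Finset.measurable_sum _ fun k _ => (measurable_optimalWeight hτ t k).mul (hx k)

/-- The optimal error for a modulus continuous on the whole line. -/
theorem optimalError_eq_of_continuous {Ω : Type*} [MeasurableSpace Ω] {P : Measure Ω}
    [IsProbabilityMeasure P] {ω : ℝ → ℝ} (hω : IsConcaveModulus ω) (hc : Continuous ω)
    {m : ℕ} {t : Fin (m + 1) → ℝ} (ht0 : t 0 = 0) (ht : Monotone t)
    {τ : Ω → Set.Icc (0 : ℝ) 1} (hτ : Measurable τ)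
    {τs : Fin (m + 1) → Ω → Set.Icc (0 : ℝ) 1} (hτs : ∀ k, Measurable (τs k))
    (hτs_eq : ∀ k, ∀ᵐ w ∂P, (τs k w : ℝ) = (τ w : ℝ) + t k) {u : ℝ}
    (hu : u = supNorm P (fun w => (τ w : ℝ) - (1 - t (Fin.last m)) / 2))
    (hua : u ≤ (1 - t (Fin.last m)) / 2)
    (hτu : ∀ᵐ w ∂P, |(τ w : ℝ) - (1 - t (Fin.last m)) / 2| ≤ u) :
    optimalError P ω τs = ENNReal.ofReal
        (2 * ∑ k : Fin m, modulusIntegral ω ((t k.succ - t k.castSucc) / 2)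
          + modulusIntegral ω ((1 - t (Fin.last m)) / 2 - u)
          + modulusIntegral ω ((1 - t (Fin.last m)) / 2 + u)) ∧
      recoveryError P ω τs (optimalQuadrature τ t) = optimalError P ω τs := by
  have hu0 : 0 ≤ u := hu ▸ supNorm_nonneg _ _
  have h1 : optimalError P ω τs ≤ recoveryError P ω τs (optimalQuadrature τ t) :=
    iInf₂_le _ (isRecoveryMethod_optimalQuadrature hτ t)
  have h2 := recoveryError_optimalQuadrature_le hω hc ht0 ht hτ hτs_eq hu0 hua hτu
  have h3 : ENNReal.ofReal
        (2 * ∑ k : Fin m, modulusIntegral ω ((t k.succ - t k.castSucc) / 2)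
          + modulusIntegral ω ((1 - t (Fin.last m)) / 2 - u)
          + modulusIntegral ω ((1 - t (Fin.last m)) / 2 + u)) ≤ optimalError P ω τs := by
    have hI := continuous_modulusIntegral hc
    have hcont : Continuous fun r : ℝ => ENNReal.ofReal
        (2 * ∑ k : Fin m, modulusIntegral ω ((t k.succ - t k.castSucc) / 2)
          + modulusIntegral ω ((1 - t (Fin.last m)) / 2 - max r 0)
          + modulusIntegral ω ((1 - t (Fin.last m)) / 2 + max r 0)) :=
      ENNReal.continuous_ofReal.comp (by fun_prop)
    -- The lower bound is known only for `r < u`, so the limit is taken from the left.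
    have hlim := (hcont.tendsto u).mono_left (nhdsWithin_le_nhds (s := Set.Iio u))
    simp only [max_eq_left hu0] at hlim
    refine le_of_tendsto hlim ?_
    filter_upwards [self_mem_nhdsWithin] with r hr
    exact le_optimalError_of_lt hω hc ht0 ht hτ hτs hτs_eq (hu ▸ hr)
  exact ⟨le_antisymm (h1.trans h2) h3, le_antisymm (h2.trans h3) h1⟩

/-- The number of nodes is `n = m + 1`, and `t 0, …, t (Fin.last m)` are `t_1, …, t_n`. The
`[0, 1]`-valued random variables `τ_k` equal `τ + t_k` almost everywhere; in particular
`τ + t_n ≤ 1` almost everywhere. -/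
theorem theorem2 {Ω : Type*} [MeasurableSpace Ω] (P : Measure Ω) [IsProbabilityMeasure P]
    (ω : ℝ → ℝ) (hω : IsConcaveModulus ω)
    (m : ℕ) (t : Fin (m + 1) → ℝ) (ht0 : t 0 = 0) (ht : StrictMono t)
    (τ : Ω → Set.Icc (0 : ℝ) 1) (hτ : Measurable τ)
    (τs : Fin (m + 1) → Ω → Set.Icc (0 : ℝ) 1) (hτs : ∀ k, Measurable (τs k))
    (hτs_eq : ∀ k, ∀ᵐ w ∂P, (τs k w : ℝ) = (τ w : ℝ) + t k)
    (tstar : ℝ)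
    (htstar : tstar = supNorm P (fun w => (τ w : ℝ) - (1 - t (Fin.last m)) / 2)) :
    optimalError P ω τs = ENNReal.ofReal
        (2 * ∑ k : Fin m, modulusIntegral ω ((t k.succ - t k.castSucc) / 2)
          + modulusIntegral ω ((1 - t (Fin.last m)) / 2 - tstar)
          + modulusIntegral ω ((1 - t (Fin.last m)) / 2 + tstar)) ∧
      IsRecoveryMethod (optimalQuadrature τ t) ∧
      recoveryError P ω τs (optimalQuadrature τ t) = optimalError P ω τs := by
  have hτT : ∀ᵐ w ∂P, |(τ w : ℝ) - (1 - t (Fin.last m)) / 2| ≤ (1 - t (Fin.last m)) / 2 := by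
    filter_upwards [hτs_eq (Fin.last m)] with w hw
    have h0 : 0 ≤ (τ w : ℝ) := (τ w).2.1
    have h1 : (τ w : ℝ) + t (Fin.last m) ≤ 1 := hw ▸ (τs (Fin.last m) w).2.2
    rw [abs_le]
    constructor <;> linarith
  have ha0 : 0 ≤ (1 - t (Fin.last m)) / 2 := by
    obtain ⟨w, hw⟩ := hτT.exists
    exact (abs_nonneg _).trans hw
  have hua : tstar ≤ (1 - t (Fin.last m)) / 2 := htstar ▸ supNorm_le ha0 hτT
  have hτu : ∀ᵐ w ∂P, |(τ w : ℝ) - (1 - t (Fin.last m)) / 2| ≤ tstar :=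
    htstar ▸ ae_abs_le_supNorm hτT
  have hu0 : 0 ≤ tstar := htstar ▸ supNorm_nonneg _ _
  -- The result is applied to `ω |x|` and carried back; every argument of `I` that occurs is
  -- nonnegative.
  have h := optimalError_eq_of_continuous hω.comp_abs hω.continuous_comp_abs ht0 ht.monotone hτ
    hτs hτs_eq htstar hua hτu
  rw [modulusIntegral_comp_abs ω (sub_nonneg.2 hua), modulusIntegral_comp_abs ω (by linarith),
    Finset.sum_congr rfl fun k _ => modulusIntegral_comp_abs ω (x := (t (Fin.succ k)
      - t k.castSucc) / 2) (by linarith [ht.monotone (Fin.castSucc_le_succ k)])] at h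
  simp only [optimalError, recoveryError, processClass_comp_abs] at h ⊢
  exact ⟨h.1, isRecoveryMethod_optimalQuadrature hτ t, h.2⟩
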